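/- **Proposition 1.2.** Let $\xi_1,\xi_2,\dots$ be i.i.d. real random variables, let $W_n=\sum_{i=1}^n\xi_i$, and suppose that $\mathbb P(W_n<0)$ converges, as $n\to\infty$, to a limit $q<1$. Then $\{\xi_i\}_{i\ge1}$ is persistently power-skewed: the sequence $\{\xi_i\}_{i\ge1}$ is stationary, $\mathbb P(W_1\ge0,\dots,W_n\ge0)>0$ for every $n$, and $$\lim_{n\to\infty}\left|\frac{\log\mathbb P(W_1\ge0,\dots,W_n\ge0)}{\log n}+\mathbb P(W_n<0)\right|=0 .$$ Consequently, $$\lim_{n\to\infty}\frac{\log\mathbb P(W_1\ge0,\dots,W_n\ge0)}{\log n}=-q .$$ -/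

import Mathlib

open MeasureTheory ProbabilityTheory Filter Topology

noncomputable section

/-- The partial sums `W_n = ξ_1 + ⋯ + ξ_n`; the term `ξ i` of the Lean sequence is `ξ_{i+1}`. -/
def partialSum {Ω : Type*} (ξ : ℕ → Ω → ℝ) (n : ℕ) (ω : Ω) : ℝ :=
  ∑ i ∈ Finset.range n, ξ i ω

/-- The persistence probability `P(W_1 ≥ 0, …, W_n ≥ 0)`. -/
def persistenceProb {Ω : Type*} [MeasurableSpace Ω] (μ : Measure Ω) (ξ : ℕ → Ω → ℝ) (n : ℕ) : ℝ :=
  μ.real {ω | ∀ k, 1 ≤ k → k ≤ n → 0 ≤ partialSum ξ k ω}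

/-- The probability `P(W_n < 0)`. -/
def negProb {Ω : Type*} [MeasurableSpace Ω] (μ : Measure Ω) (ξ : ℕ → Ω → ℝ) (n : ℕ) : ℝ :=
  μ.real {ω | partialSum ξ n ω < 0}

/-- (Strict) stationarity: the sequence and its shift have the same law on `ℕ → ℝ`. -/
def IsStationarySeq {Ω : Type*} [MeasurableSpace Ω] (μ : Measure Ω) (ξ : ℕ → Ω → ℝ) : Prop :=
  IdentDistrib (fun ω i => ξ (i + 1) ω) (fun ω i => ξ i ω) μ μ

/-- A stationary sequence is persistently power-skewed if
`log P(W_1 ≥ 0, …, W_n ≥ 0) / log n + P(W_n < 0)` tends to `0`. The field `pos` says that the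
logarithms are finite (`Real.log 0` is `0` in Mathlib, where mathematically it is `-∞`). -/
structure IsPersistentlyPowerSkewed {Ω : Type*} [MeasurableSpace Ω] (μ : Measure Ω)
    (ξ : ℕ → Ω → ℝ) : Prop where
  stationary : IsStationarySeq μ ξ
  pos : ∀ n, 0 < persistenceProb μ ξ n
  tendsto : Tendsto
    (fun n : ℕ => |Real.log (persistenceProb μ ξ n) / Real.log (n : ℝ) + negProb μ ξ n|)
    atTop (𝓝 0)

end

/-! Let `u n` be the persistence probability, `a n = P(W_n ≥ 0)`, and `f k` the probability of
`strictMinAt k`. Cutting a persistent path at its first minimum over times `1, …, n` gives the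
renewal equation `u n = ∑ f k * u (n - k)`. Cyclic rotations of the steps preserve the law, and `W_n
≥ 0` exactly when some rotation is persistent; sorting by the last such rotation weights the same
terms by `k`: `a n = ∑ k * f k * u (n - k)` (`infinitePi_real_walk_nonneg`). Eliminating `f` by
generating functions yields Sparre Andersen's identity `n * u n = ∑ a k * u (n - k)`
(`renewal_log_deriv`).

Since `a` tends to `ρ = 1 - q > 0` and `u` is antitone, `n * u n` is asymptotic to `ρ * U n` with `U
n = ∑ k < n, u k`. Hence `log (U n)` grows like `ρ * log n`, and `log (u n)` like `(ρ - 1) * log n =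
-q * log n`. -/

/-! ### Cyclic rotations and first minima of paths -/

/-- The walk with steps `x`, started at `0`. -/
def walk (x : ℕ → ℝ) (n : ℕ) : ℝ := ∑ i ∈ Finset.range n, x i

/-- Paths staying nonnegative up to time `n`. -/
def persistent (n : ℕ) : Set (ℕ → ℝ) := {x | ∀ k ≤ n, 0 ≤ walk x k}

/-- Paths whose value at time `k` is nonnegative and is a strict minimum over times `1, …, k`. -/
def strictMinAt (k : ℕ) : Set (ℕ → ℝ) :=
  {x | 0 ≤ walk x k ∧ ∀ i, 0 < i → i < k → walk x k < walk x i}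

/-- Persistent paths up to time `n` whose first minimum over times `1, …, n` is at time `k`. -/
def firstMinAt (n k : ℕ) : Set (ℕ → ℝ) :=
  {x | x ∈ strictMinAt k ∧ ∀ j, k ≤ j → j ≤ n → walk x k ≤ walk x j}

/-- The index map rotating the first `n` indices by `v`. -/
def rotIndex (n v i : ℕ) : ℕ := if i < n then (i + v) % n else i

/-- The sequence `x` with its first `n` terms rotated by `v`. -/
def rot (n v : ℕ) (x : ℕ → ℝ) : ℕ → ℝ := fun i => x (rotIndex n v i)

lemma rotIndex_injective (n v : ℕ) : Function.Injective (rotIndex n v) := by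
  intro i j h
  unfold rotIndex at h
  rcases Nat.eq_zero_or_pos n with rfl | hn
  · simpa using h
  split_ifs at h with hi hj hj
  · have : i ≡ j [MOD n] := Nat.ModEq.add_right_cancel' v h
    rwa [Nat.ModEq, Nat.mod_eq_of_lt hi, Nat.mod_eq_of_lt hj] at this
  · exact absurd (h ▸ Nat.mod_lt _ hn) hj
  · exact absurd (h ▸ Nat.mod_lt _ hn) hi
  · exact h

lemma rot_rot (n v i : ℕ) (x : ℕ → ℝ) : rot n i (rot n v x) = rot n (v + i) x := by
  funext j
  unfold rot
  congr 1
  unfold rotIndex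
  rcases Nat.eq_zero_or_pos n with rfl | hn
  · simp
  by_cases hj : j < n
  · simp only [hj, if_true, Nat.mod_lt _ hn, Nat.mod_add_mod]
    congr 1; ring
  · simp [hj]

lemma walk_rot {n v j : ℕ} (hv : v ≤ n) (hj : j ≤ n) (x : ℕ → ℝ) :
    walk (rot n v x) j = if v + j ≤ n then walk x (v + j) - walk x v
      else walk x n - walk x v + walk x (v + j - n) := by
  induction j with
  | zero => simp [walk, hv]
  | succ j ih =>
    have ih := ih (by omega)
    have hs : ∀ (y : ℕ → ℝ) m, walk y (m + 1) = walk y m + y m := fun y m =>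
      Finset.sum_range_succ _ _
    rw [hs, ih]
    have hr : rot n v x j = if v + j < n then x (v + j) else x (v + j - n) := by
      simp only [rot, rotIndex]
      rw [if_pos (by omega)]
      split_ifs with h
      · rw [Nat.mod_eq_of_lt (by omega), add_comm]
      · rw [Nat.mod_eq_sub_mod (by omega), Nat.mod_eq_of_lt (by omega), add_comm]
    rw [hr]
    rcases lt_trichotomy (v + j) n with h | h | h
    · rw [if_pos h.le, if_pos h, if_pos (by omega), ← add_assoc, hs]; ring
    · rw [if_pos h.le, if_neg (by omega), if_neg (by omega), h,
        show v + (j + 1) - n = 0 + 1 by omega, hs]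
      simp [walk]
    · rw [if_neg (by omega), if_neg (by omega), if_neg (by omega),
        show v + (j + 1) - n = (v + j - n) + 1 by omega, hs]
      ring

/-- The rotated walk is the original seen from time `v`; after wrapping around it replays times `j ≤
v`, raised by `walk x n`. -/
lemma rot_mem_persistent_iff {n v : ℕ} (hv : v ≤ n) (x : ℕ → ℝ) :
    rot n v x ∈ persistent n ↔ (∀ j, v ≤ j → j ≤ n → walk x v ≤ walk x j) ∧
      ∀ j ≤ v, walk x v ≤ walk x n + walk x j := by
  constructor
  · intro h
    have h1 : ∀ j, v ≤ j → j ≤ n → walk x v ≤ walk x j := by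
      intro j hvj hj
      have := h (j - v) (by omega)
      rw [walk_rot hv (by omega), if_pos (by omega), Nat.add_sub_cancel' hvj] at this
      linarith
    refine ⟨h1, fun j hj => ?_⟩
    rcases Nat.eq_zero_or_pos j with rfl | hj0
    · simpa [walk] using h1 n hv le_rfl
    · have := h (j + n - v) (by omega)
      rw [walk_rot hv (by omega), if_neg (by omega), show v + (j + n - v) - n = j by omega] at this
      linarith
  · rintro ⟨h1, h2⟩ j hj
    rw [walk_rot hv hj]
    split_ifs with h
    · linarith [h1 (v + j) (by omega) h]
    · linarith [h2 (v + j - n) (by omega)]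

lemma exists_rot_mem_persistent_iff {n : ℕ} (hn : 0 < n) (x : ℕ → ℝ) :
    (∃ v ∈ Finset.Icc 1 n, rot n v x ∈ persistent n) ↔ 0 ≤ walk x n := by
  constructor
  · rintro ⟨v, hv, h⟩
    rw [Finset.mem_Icc] at hv
    rw [rot_mem_persistent_iff hv.2] at h
    linarith [h.2 v le_rfl]
  · intro h
    obtain ⟨v, hv, hmin⟩ := (Finset.Icc 1 n).exists_min_image (walk x) ⟨1, by simp; omega⟩
    refine ⟨v, hv, ?_⟩
    rw [Finset.mem_Icc] at hv
    rw [rot_mem_persistent_iff hv.2]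
    refine ⟨fun j h1 h2 => hmin j (by simp; omega), fun j hj => ?_⟩
    rcases Nat.eq_zero_or_pos j with rfl | hj0
    · simpa [walk] using hmin n (by simp; omega)
    · linarith [hmin j (by simp; omega)]

lemma mem_persistent_of_mem_firstMinAt {n k : ℕ} {x : ℕ → ℝ} (h : x ∈ firstMinAt n k) :
    x ∈ persistent n := by
  intro j hj
  rcases Nat.eq_zero_or_pos j with rfl | hj0
  · simp [walk]
  rcases lt_or_ge j k with hjk | hjk
  · linarith [h.1.1, h.1.2 j hj0 hjk]
  · linarith [h.1.1, h.2 j hjk hj]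

/-- For a persistent path with first minimum at `k`, the rotation by `k` is persistent, while a
rotation by `0 < i < k` is not, since the walk later drops below its value at `i`. So no rotation by
`1, …, m` is persistent iff `m < k`. -/
lemma persistent_and_forall_not_rot_iff {n m : ℕ} (hn : 0 < n) (x : ℕ → ℝ) :
    (x ∈ persistent n ∧ ∀ i, 0 < i → i ≤ m → rot n i x ∉ persistent n) ↔
      x ∈ ⋃ k ∈ Finset.Ioc m n, firstMinAt n k := by
  simp only [Set.mem_iUnion, Finset.mem_Ioc, exists_prop]
  constructor
  · rintro ⟨hx, hi⟩
    classical
    obtain ⟨v, hv, hmin⟩ := (Finset.Icc 1 n).exists_min_image (walk x) ⟨1, by simp; omega⟩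
    have hex : ∃ k, k ∈ Finset.Icc 1 n ∧ walk x k = walk x v := ⟨v, hv, rfl⟩
    obtain ⟨hk, hkv⟩ := Nat.find_spec hex
    set k := Nat.find hex with hkdef
    have hfind : ∀ i, i < k → ¬ (i ∈ Finset.Icc 1 n ∧ walk x i = walk x v) :=
      fun i hi => Nat.find_min hex hi
    rw [Finset.mem_Icc] at hk
    have hF : x ∈ firstMinAt n k := by
      refine ⟨⟨hx k hk.2, fun i hi0 hik => ?_⟩, fun j h1 h2 => ?_⟩
      · have hiI : i ∈ Finset.Icc 1 n := by simp; omega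
        rw [hkv]
        exact lt_of_le_of_ne (hmin i hiI) fun h => hfind i hik ⟨hiI, h.symm⟩
      · rw [hkv]; exact hmin j (by simp; omega)
    refine ⟨k, ⟨?_, hk.2⟩, hF⟩
    by_contra! hkm
    refine hi k (by omega) hkm ((rot_mem_persistent_iff hk.2 x).2 ⟨hF.2, fun j hj => ?_⟩)
    have hn0 : 0 ≤ walk x n := hx n le_rfl
    rcases Nat.eq_zero_or_pos j with rfl | hj0
    · simpa [walk] using hF.2 n hk.2 le_rfl
    rcases hj.eq_or_lt with rfl | hjk
    · linarith
    · linarith [hF.1.2 j hj0 hjk]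
  · rintro ⟨k, ⟨hmk, hkn⟩, h⟩
    refine ⟨mem_persistent_of_mem_firstMinAt h, fun i hi0 him hrot => ?_⟩
    rw [rot_mem_persistent_iff (by omega)] at hrot
    linarith [hrot.1 k (by omega) hkn, h.1.2 i hi0 (by omega)]

lemma disjoint_firstMinAt {n k l : ℕ} (hk : 0 < k) (hkl : k < l) (hl : l ≤ n) :
    Disjoint (firstMinAt n k) (firstMinAt n l) := by
  rw [Set.disjoint_left]
  intro x h h'
  linarith [h.2 l hkl.le hl, h'.1.2 k hk hkl]

lemma pairwiseDisjoint_firstMinAt (n m : ℕ) :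
    (Finset.Ioc m n : Set ℕ).PairwiseDisjoint (firstMinAt n) := by
  intro k hk l hl hkl
  simp only [Finset.coe_Ioc, Set.mem_Ioc] at hk hl
  rcases lt_or_gt_of_ne hkl with h | h
  · exact disjoint_firstMinAt (by omega) h hl.2
  · exact (disjoint_firstMinAt (by omega) h hk.2).symm

@[fun_prop]
lemma measurable_walk (n : ℕ) : Measurable fun x => walk x n := by
  unfold walk; fun_prop

lemma measurable_rot (n v : ℕ) : Measurable (rot n v) := by
  unfold rot; fun_prop

lemma measurableSet_persistent (n : ℕ) : MeasurableSet (persistent n) := by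
  have : persistent n = ⋂ k, ⋂ (_ : k ≤ n), {x | 0 ≤ walk x k} := by
    ext; simp [persistent]
  rw [this]
  exact .iInter fun k => .iInter fun _ => measurableSet_le (by fun_prop) (by fun_prop)

lemma measurableSet_strictMinAt (k : ℕ) : MeasurableSet (strictMinAt k) := by
  have : strictMinAt k = {x | 0 ≤ walk x k} ∩
      ⋂ i, ⋂ (_ : 0 < i), ⋂ (_ : i < k), {x | walk x k < walk x i} := by
    ext; simp [strictMinAt]
  rw [this]
  exact (measurableSet_le (by fun_prop) (by fun_prop)).inter <|
    .iInter fun k => .iInter fun _ => .iInter fun _ => measurableSet_lt (by fun_prop) (by fun_prop)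

lemma measurableSet_firstMinAt (n k : ℕ) : MeasurableSet (firstMinAt n k) := by
  have : firstMinAt n k = strictMinAt k ∩
      ⋂ i, ⋂ (_ : k ≤ i), ⋂ (_ : i ≤ n), {x | walk x k ≤ walk x i} := by
    ext; simp [firstMinAt]
  rw [this]
  exact (measurableSet_strictMinAt k).inter <|
    .iInter fun k => .iInter fun _ => .iInter fun _ => measurableSet_le (by fun_prop) (by fun_prop)

/-! ### Probabilities of these events under a product measure -/

section IID

variable (ν : Measure ℝ) [IsProbabilityMeasure ν]

lemma iIndepFun_coord : iIndepFun (fun (i : ℕ) (x : ℕ → ℝ) => x i)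
    (Measure.infinitePi fun _ : ℕ => ν) := by
  rw [iIndepFun_iff_map_fun_eq_infinitePi_map (by fun_prop)]
  simp only [Measure.infinitePi_map_eval]
  exact Measure.map_id'

lemma measurePreserving_reindex {σ : ℕ → ℕ} (hσ : Function.Injective σ) :
    MeasurePreserving (fun (x : ℕ → ℝ) i => x (σ i)) (Measure.infinitePi fun _ : ℕ => ν)
      (Measure.infinitePi fun _ : ℕ => ν) := by
  refine ⟨by fun_prop, ?_⟩
  have h := ((iIndepFun_coord ν).precomp hσ)
  rw [iIndepFun_iff_map_fun_eq_infinitePi_map (by fun_prop)] at h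
  simpa only [Measure.infinitePi_map_eval] using h

/-- The first `k` terms of a sequence, followed by zeros. -/
def trunc (k : ℕ) (x : ℕ → ℝ) : ℕ → ℝ := fun i => if i < k then x i else 0

lemma walk_trunc {k j : ℕ} (h : j ≤ k) (x : ℕ → ℝ) : walk (trunc k x) j = walk x j := by
  refine Finset.sum_congr rfl fun i hi => ?_
  rw [Finset.mem_range] at hi
  simp [trunc, hi.trans_le h]

/-- Both maps factor through disjoint finite blocks of coordinates; truncation makes the blocks
finite. -/
lemma indepFun_trunc_shift (k m : ℕ) :
    IndepFun (trunc k) (fun x => trunc m fun i => x (i + k))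
      (Measure.infinitePi fun _ : ℕ => ν) := by
  have h := (iIndepFun_coord ν).indepFun_finset (Finset.range k) (Finset.Ico k (m + k))
    (by rw [Finset.disjoint_left]; intro i; simp; omega) (by fun_prop)
  let φ : (Finset.range k → ℝ) → ℕ → ℝ := fun y i =>
    if hi : i < k then y ⟨i, Finset.mem_range.2 hi⟩ else 0
  let ψ : (Finset.Ico k (m + k) → ℝ) → ℕ → ℝ := fun y i =>
    if hi : i < m then y ⟨i + k, Finset.mem_Ico.2 ⟨by omega, by omega⟩⟩ else 0
  have hφ : Measurable φ := by
    refine measurable_pi_lambda _ fun i => ?_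
    simp only [φ]
    split_ifs <;> fun_prop
  have hψ : Measurable ψ := by
    refine measurable_pi_lambda _ fun i => ?_
    simp only [ψ]
    split_ifs <;> fun_prop
  exact h.comp hφ hψ

lemma walk_shift (k j : ℕ) (x : ℕ → ℝ) :
    walk (fun i => x (i + k)) j = walk x (k + j) - walk x k := by
  rw [walk, walk, walk, Finset.sum_range_add, add_sub_cancel_left]
  simp only [add_comm]

lemma infinitePi_real_firstMinAt {n k : ℕ} (hk : k ≤ n) :
    (Measure.infinitePi fun _ : ℕ => ν).real (firstMinAt n k) =
      (Measure.infinitePi fun _ : ℕ => ν).real (strictMinAt k) *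
      (Measure.infinitePi fun _ : ℕ => ν).real (persistent (n - k)) := by
  have hA : trunc k ⁻¹' strictMinAt k = strictMinAt k := by
    ext x
    simp only [strictMinAt, Set.mem_preimage, Set.mem_ofPred_eq, walk_trunc le_rfl]
    refine and_congr_right fun _ => forall_congr' fun i => forall_congr' fun _ =>
      forall_congr' fun h => by rw [walk_trunc h.le]
  have hB (m : ℕ) : trunc m ⁻¹' persistent m = persistent m := by
    ext x
    simp only [persistent, Set.mem_preimage, Set.mem_ofPred_eq]
    exact forall_congr' fun i => forall_congr' fun h => by rw [walk_trunc h]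
  have hF : firstMinAt n k = trunc k ⁻¹' strictMinAt k ∩
      (fun x => trunc (n - k) fun i => x (i + k)) ⁻¹' persistent (n - k) := by
    rw [hA]
    ext x
    refine and_congr_right fun _ => ?_
    change _ ↔ (fun i => x (i + k)) ∈ trunc (n - k) ⁻¹' persistent (n - k)
    rw [hB]
    simp only [persistent, Set.mem_ofPred_eq, walk_shift, sub_nonneg]
    constructor
    · intro h j hj
      exact h _ (by omega) (by omega)
    · intro h j h1 h2
      simpa [Nat.add_sub_cancel' h1] using h (j - k) (by omega)
  have hmp := measurePreserving_reindex ν (add_left_injective k)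
  have := congrArg ENNReal.toReal <|
    (indepFun_trunc_shift ν k (n - k)).measure_inter_preimage_eq_mul _ _
    (measurableSet_strictMinAt k) (measurableSet_persistent (n - k))
  rw [hF, Measure.real, this, ENNReal.toReal_mul, hA]
  congr 1
  change Measure.real _ _ = _
  change Measure.real _ ((fun (x : ℕ → ℝ) i => x (i + k)) ⁻¹' (trunc (n - k) ⁻¹' persistent (n - k))) = _
  rw [hB]
  exact hmp.measureReal_preimage (measurableSet_persistent _).nullMeasurableSet

lemma infinitePi_real_persistent_not_rot {n : ℕ} (hn : 0 < n) (m : ℕ) :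
    (Measure.infinitePi fun _ : ℕ => ν).real
      {x | x ∈ persistent n ∧ ∀ i, 0 < i → i ≤ m → rot n i x ∉ persistent n} =
    ∑ k ∈ Finset.Ioc m n, (Measure.infinitePi fun _ : ℕ => ν).real (strictMinAt k) *
      (Measure.infinitePi fun _ : ℕ => ν).real (persistent (n - k)) := by
  have : {x | x ∈ persistent n ∧ ∀ i, 0 < i → i ≤ m → rot n i x ∉ persistent n} =
      ⋃ k ∈ Finset.Ioc m n, firstMinAt n k := by
    ext x; exact persistent_and_forall_not_rot_iff hn x
  rw [this, measureReal_biUnion_finset (pairwiseDisjoint_firstMinAt n m)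
    fun k _ => measurableSet_firstMinAt n k]
  exact Finset.sum_congr rfl fun k hk => infinitePi_real_firstMinAt ν (Finset.mem_Ioc.1 hk).2

lemma infinitePi_real_persistent {n : ℕ} (hn : 0 < n) :
    (Measure.infinitePi fun _ : ℕ => ν).real (persistent n) =
    ∑ k ∈ Finset.Ioc 0 n, (Measure.infinitePi fun _ : ℕ => ν).real (strictMinAt k) *
      (Measure.infinitePi fun _ : ℕ => ν).real (persistent (n - k)) := by
  rw [← infinitePi_real_persistent_not_rot ν hn 0]
  congr 1
  ext x
  simp only [Set.mem_ofPred_eq, iff_self_and]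
  intros; omega

lemma infinitePi_real_walk_nonneg {n : ℕ} (hn : 0 < n) :
    (Measure.infinitePi fun _ : ℕ => ν).real {x | 0 ≤ walk x n} =
    ∑ k ∈ Finset.Ioc 0 n, k * ((Measure.infinitePi fun _ : ℕ => ν).real (strictMinAt k) *
      (Measure.infinitePi fun _ : ℕ => ν).real (persistent (n - k))) := by
  set P := Measure.infinitePi fun _ : ℕ => ν with hP
  let B : ℕ → Set (ℕ → ℝ) := fun m =>
    {x | x ∈ persistent n ∧ ∀ i, 0 < i → i ≤ m → rot n i x ∉ persistent n}
  have hBm (m : ℕ) : MeasurableSet (B m) := by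
    have : B m = persistent n ∩
        ⋂ i, ⋂ (_ : 0 < i), ⋂ (_ : i ≤ m), (rot n i ⁻¹' persistent n)ᶜ := by
      ext; simp [B]
    rw [this]
    exact (measurableSet_persistent n).inter <| .iInter fun i => .iInter fun _ => .iInter fun _ =>
      (measurable_rot n i (measurableSet_persistent n)).compl
  -- The last persistent rotation among `1, …, n` is `n - m` with `m` minimal: rotating further by
  -- `1, …, m` never gives a persistent path.
  have hlast : {x | 0 ≤ walk x n} = ⋃ m ∈ Finset.range n, rot n (n - m) ⁻¹' B m := by
    ext x
    rw [Set.mem_ofPred_eq, ← exists_rot_mem_persistent_iff hn]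
    simp only [Set.mem_iUnion, Finset.mem_range, exists_prop, Set.mem_preimage, B,
      Set.mem_ofPred_eq, rot_rot]
    constructor
    · intro hex
      classical
      have hex' : ∃ m, m < n ∧ rot n (n - m) x ∈ persistent n := by
        obtain ⟨v, hv, h⟩ := hex
        rw [Finset.mem_Icc] at hv
        exact ⟨n - v, by omega, by rwa [Nat.sub_sub_self hv.2]⟩
      refine ⟨Nat.find hex', (Nat.find_spec hex').1, (Nat.find_spec hex').2, ?_⟩
      intro i hi0 him hr
      have hlt := (Nat.find_spec hex').1
      refine Nat.find_min hex' (m := Nat.find hex' - i) (by omega) ⟨by omega, ?_⟩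
      rwa [show n - (Nat.find hex' - i) = n - Nat.find hex' + i by omega]
    · rintro ⟨m, hm, h, -⟩
      exact ⟨n - m, by simp; omega, h⟩
  have hdisj : (Finset.range n : Set ℕ).PairwiseDisjoint fun m => rot n (n - m) ⁻¹' B m := by
    have key : ∀ m l, m < l → l < n → Disjoint (rot n (n - m) ⁻¹' B m) (rot n (n - l) ⁻¹' B l) := by
      intro m l hml hl
      rw [Set.disjoint_left]
      rintro x ⟨h, -⟩ ⟨-, h'⟩
      refine h' (l - m) (by omega) (by omega) ?_
      rwa [rot_rot, show n - l + (l - m) = n - m by omega]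
    intro m hm l hl hml
    simp only [Finset.coe_range, Set.mem_Iio] at hm hl
    rcases lt_or_gt_of_ne hml with h | h
    · exact key m l h hl
    · exact (key l m h hm).symm
  rw [hlast, measureReal_biUnion_finset hdisj fun m _ => measurable_rot n _ (hBm m)]
  have hsum : ∀ m ∈ Finset.range n, P.real (rot n (n - m) ⁻¹' B m) =
      ∑ k ∈ Finset.Ioc 0 n, if m < k then P.real (strictMinAt k) * P.real (persistent (n - k))
        else 0 := by
    intro m hm
    rw [Finset.mem_range] at hm
    have hmp := measurePreserving_reindex ν (rotIndex_injective n (n - m))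
    have h1 : P.real (rot n (n - m) ⁻¹' B m) = P.real (B m) :=
      hmp.measureReal_preimage (hBm m).nullMeasurableSet
    rw [h1, infinitePi_real_persistent_not_rot ν hn m, ← Finset.sum_filter]
    refine Finset.sum_congr ?_ fun _ _ => rfl
    ext k; simp; omega
  -- The term of index `k` occurs once for each `m < k`, hence the factor `k`.
  rw [Finset.sum_congr rfl hsum, Finset.sum_comm]
  refine Finset.sum_congr rfl fun k hk => ?_
  rw [Finset.mem_Ioc] at hk
  rw [← Finset.sum_filter, Finset.sum_const, nsmul_eq_mul]
  congr 2
  rw [show {m ∈ Finset.range n | m < k} = Finset.range k by ext; simp; omega, Finset.card_range]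

end IID

/-! ### Generating functions -/

/-- The logarithmic derivative of a renewal sequence: if `u` is the renewal sequence of `f` and
`a` is the convolution of `k ↦ k * f k` with `u`, then `n * u n` is the convolution of `a` and
`u`. -/
lemma renewal_log_deriv {u f a : ℕ → ℝ} (hu0 : u 0 = 1)
    (hu : ∀ n, 0 < n → u n = ∑ k ∈ Finset.Ioc 0 n, f k * u (n - k))
    (ha : ∀ n, 0 < n → a n = ∑ k ∈ Finset.Ioc 0 n, k * (f k * u (n - k))) (n : ℕ) :
    n * u n = ∑ k ∈ Finset.Ioc 0 n, a k * u (n - k) := by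
  let U : PowerSeries ℝ := .mk u
  -- The sums start at `k = 1`, so the values of `f` and `a` at `0` are discarded.
  let F : PowerSeries ℝ := .mk fun k => if k = 0 then 0 else f k
  let A : PowerSeries ℝ := .mk fun k => if k = 0 then 0 else a k
  let G : PowerSeries ℝ := .mk fun k => k * if k = 0 then 0 else f k
  let D : PowerSeries ℝ := .mk fun k => k * u k
  have conv (g : ℕ → ℝ) (hg : g 0 = 0) (n : ℕ) :
      PowerSeries.coeff n (PowerSeries.mk g * U) = ∑ k ∈ Finset.Ioc 0 n, g k * u (n - k) := by
    rw [PowerSeries.coeff_mul, Finset.Nat.sum_antidiagonal_eq_sum_range_succ_mk]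
    simp only [PowerSeries.coeff_mk, U]
    rw [Finset.sum_range_succ', hg, zero_mul, add_zero]
    rw [show Finset.Ioc 0 n = Finset.Ico (0 + 1) (n + 1) by ext; simp; omega,
      ← Finset.sum_Ico_add' (fun k => g k * u (n - k)) 0 n 1, Finset.range_eq_Ico]
  have pos_of {n k : ℕ} (hk : k ∈ Finset.Ioc 0 n) : k ≠ 0 := by
    rw [Finset.mem_Ioc] at hk; omega
  have hU : U = 1 + F * U := by
    ext n
    rw [map_add, conv _ (by simp)]
    rcases Nat.eq_zero_or_pos n with rfl | hn
    · simp [U, hu0]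
    · rw [PowerSeries.coeff_one, if_neg hn.ne', zero_add, PowerSeries.coeff_mk, hu n hn]
      exact Finset.sum_congr rfl fun k hk => by rw [if_neg (pos_of hk)]
  have hA : A = G * U := by
    ext n
    rw [conv _ (by simp), PowerSeries.coeff_mk]
    split_ifs with hn
    · simp [hn]
    · rw [ha n (by omega)]
      exact Finset.sum_congr rfl fun k hk => by rw [if_neg (pos_of hk)]; ring
  -- This is `U = 1 + F * U` under the derivation `X * d/dX`, which sends `U` to `D` and `F` to `G`.
  have hD : D = G * U + F * D := by
    ext n
    rw [map_add, PowerSeries.coeff_mul, PowerSeries.coeff_mul, ← Finset.sum_add_distrib]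
    have := congrArg (PowerSeries.coeff n) hU
    rw [map_add, PowerSeries.coeff_mul] at this
    have h0 : (n : ℝ) * PowerSeries.coeff n (1 : PowerSeries ℝ) = 0 := by
      rw [PowerSeries.coeff_one]; split_ifs with h <;> simp [h]
    calc PowerSeries.coeff n D = n * PowerSeries.coeff n U := by simp [D, U]
      _ = _ := by
        rw [this, mul_add, h0, zero_add, Finset.mul_sum]
        refine Finset.sum_congr rfl fun p hp => ?_
        rw [Finset.HasAntidiagonal.mem_antidiagonal] at hp
        rw [← hp]
        simp only [F, U, G, D, PowerSeries.coeff_mk]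
        push_cast
        ring
  have hDA : D = A * U := by
    have h1 : D * (1 - F) = A := by rw [hA]; linear_combination hD
    have h2 : (1 - F) * U = 1 := by linear_combination hU
    rw [← h1, mul_assoc, h2, mul_one]
  have := congrArg (PowerSeries.coeff n) hDA
  rw [conv _ (by simp), PowerSeries.coeff_mk] at this
  rw [this]
  exact Finset.sum_congr rfl fun k hk => by rw [if_neg (pos_of hk)]

/-! ### Asymptotics of the recursion -/

section Asymptotics

variable {u a : ℕ → ℝ} {ρ : ℝ}

/-- If `a 1 > 0`, the term `k = 1` propagates positivity. Otherwise `u` vanishes from `1` on, and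
the term `k = n` forces `a n = 0`, against `ρ > 0`. -/
lemma pos_of_log_deriv (hu0 : u 0 = 1) (hanti : Antitone u) (hnn : ∀ n, 0 ≤ u n)
    (ha0 : ∀ n, 0 ≤ a n)
    (hrec : ∀ n : ℕ, n * u n = ∑ k ∈ Finset.Ioc 0 n, a k * u (n - k))
    (ha : Tendsto a atTop (𝓝 ρ)) (hρ : 0 < ρ) (n : ℕ) : 0 < u n := by
  have ha1 : 0 < a 1 := by
    by_contra! h
    have h1 : u 1 ≤ 0 := by simpa [hu0] using (hrec 1).trans_le (by simpa [hu0] using h)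
    have hz : ∀ n, 1 ≤ n → u n = 0 := fun n hn => le_antisymm ((hanti hn).trans h1) (hnn n)
    have haz : ∀ n, 1 ≤ n → a n = 0 := by
      intro n hn
      have := hrec n
      rw [hz n hn, mul_zero] at this
      have h2 := (Finset.sum_eq_zero_iff_of_nonneg
        fun k _ => mul_nonneg (ha0 k) (hnn (n - k))).1 this.symm n (by simp; omega)
      simpa [hu0] using h2
    have : Tendsto a atTop (𝓝 0) :=
      tendsto_const_nhds.congr' (by filter_upwards [eventually_ge_atTop 1] with n hn
                                    exact (haz n hn).symm)
    exact hρ.ne' (tendsto_nhds_unique ha this)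
  induction n with
  | zero => simp [hu0]
  | succ n ih =>
    have h : a 1 * u (n + 1 - 1) ≤ ∑ k ∈ Finset.Ioc 0 (n + 1), a k * u (n + 1 - k) :=
      Finset.single_le_sum (f := fun k => a k * u (n + 1 - k))
        (fun k _ => mul_nonneg (ha0 k) (hnn _)) (by simp)
    rw [← hrec, Nat.add_sub_cancel] at h
    exact pos_of_mul_pos_right ((mul_pos ha1 ih).trans_le h) (by positivity)

/-- The quotient is an average of the `a k` with weights `u (n - k)`. The terms `k ≤ K` weigh at
most `K * u (n - K)`, negligible because monotonicity gives `(n - K) * u (n - K) ≤ U`. -/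
lemma tendsto_mul_div_sum (hu0 : u 0 = 1) (hanti : Antitone u) (hnn : ∀ n, 0 ≤ u n)
    (hrec : ∀ n : ℕ, n * u n = ∑ k ∈ Finset.Ioc 0 n, a k * u (n - k))
    (ha : Tendsto a atTop (𝓝 ρ)) :
    Tendsto (fun n : ℕ => n * u n / ∑ k ∈ Finset.range n, u k) atTop (𝓝 ρ) := by
  have hU1 : ∀ n, 1 ≤ n → 1 ≤ ∑ k ∈ Finset.range n, u k := fun n hn => by
    rw [← hu0]
    exact Finset.single_le_sum (f := u) (fun k _ => hnn k) (by simp; omega)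
  have hrefl (n : ℕ) : ∑ k ∈ Finset.Ioc 0 n, u (n - k) = ∑ k ∈ Finset.range n, u k := by
    rw [← Finset.sum_range_reflect]
    rw [show Finset.Ioc 0 n = Finset.Ico (0 + 1) (n + 1) by ext; simp; omega,
      ← Finset.sum_Ico_add' (fun k => u (n - k)) 0 n 1, Finset.range_eq_Ico]
    exact Finset.sum_congr rfl fun k _ => by congr 1; omega
  obtain ⟨M, hM⟩ : ∃ M, ∀ k, |a k - ρ| ≤ M := by
    have := (ha.sub_const ρ).abs.bddAbove_range
    exact ⟨_, fun k => this.some_mem ⟨k, rfl⟩⟩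
  have hM0 : 0 ≤ M := (abs_nonneg _).trans (hM 0)
  rw [Metric.tendsto_atTop] at ha ⊢
  intro ε hε
  obtain ⟨K, hK⟩ := ha (ε / 2) (by positivity)
  obtain ⟨N, hN⟩ := exists_nat_gt (M * K / (ε / 2))
  refine ⟨N + K + 1, fun n hn => ?_⟩
  have hUpos : 0 < ∑ k ∈ Finset.range n, u k := one_pos.trans_le (hU1 n (by omega))
  set U := ∑ k ∈ Finset.range n, u k with hUdef
  have hlarge : ((n - K : ℕ) : ℝ) * u (n - K) ≤ U := by
    calc ((n - K : ℕ) : ℝ) * u (n - K) = ∑ k ∈ Finset.range (n - K), u (n - K) := by simp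
      _ ≤ ∑ k ∈ Finset.range (n - K), u k :=
        Finset.sum_le_sum fun k hk => hanti (Finset.mem_range.1 hk).le
      _ ≤ U := Finset.sum_le_sum_of_subset_of_nonneg (by intro k; simp; omega) fun k _ _ => hnn k
  have hsplit : |n * u n - ρ * U| ≤ M * K * u (n - K) + ε / 2 * U := by
    rw [hrec, hUdef, ← hrefl, Finset.mul_sum, ← Finset.sum_sub_distrib]
    calc |∑ k ∈ Finset.Ioc 0 n, (a k * u (n - k) - ρ * u (n - k))|
        ≤ ∑ k ∈ Finset.Ioc 0 n, |a k * u (n - k) - ρ * u (n - k)| := Finset.abs_sum_le_sum_abs _ _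
      _ ≤ ∑ k ∈ Finset.Ioc 0 n, ((if k ≤ K then M * u (n - K) else 0) + ε / 2 * u (n - k)) := by
        refine Finset.sum_le_sum fun k hk => ?_
        rw [← sub_mul, abs_mul, abs_of_nonneg (hnn _)]
        split_ifs with hkK
        · have : |a k - ρ| * u (n - k) ≤ M * u (n - K) :=
            mul_le_mul (hM k) (hanti (by omega)) (hnn _) hM0
          have := hnn (n - k)
          nlinarith
        · rw [zero_add]
          exact mul_le_mul_of_nonneg_right (hK k (by omega)).le (hnn _)
      _ = M * K * u (n - K) + ε / 2 * ∑ k ∈ Finset.Ioc 0 n, u (n - k) := by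
        rw [Finset.sum_add_distrib, ← Finset.mul_sum, ← Finset.sum_filter, Finset.sum_const,
          show {k ∈ Finset.Ioc 0 n | k ≤ K} = Finset.Ioc 0 K by ext; simp; omega]
        simp only [Nat.card_Ioc, Nat.sub_zero, nsmul_eq_mul]
        ring
  have hsmall : M * K * u (n - K) < ε / 2 * U := by
    rw [div_lt_iff₀ (by positivity)] at hN
    have hNK : (N : ℝ) + 1 ≤ ((n - K : ℕ) : ℝ) := by exact_mod_cast (by omega : N + 1 ≤ n - K)
    have h0 := hnn (n - K)
    calc M * K * u (n - K) ≤ N * (ε / 2) * u (n - K) := by gcongr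
      _ = ε / 2 * (N * u (n - K)) := by ring
      _ < ε / 2 * U := by
        refine mul_lt_mul_of_pos_left ?_ (by positivity)
        rcases h0.eq_or_lt with h | h
        · rw [← h]; simpa using hUpos
        · nlinarith
  rw [Real.dist_eq, div_sub' hUpos.ne', abs_div, abs_of_pos hUpos, div_lt_iff₀ hUpos,
    mul_comm U ρ]
  linarith

lemma tendsto_mul_log_one_add {r : ℕ → ℝ} {c : ℝ} (hr : Tendsto r atTop (𝓝 c)) :
    Tendsto (fun n : ℕ => n * Real.log (1 + r n / n)) atTop (𝓝 c) := by
  refine Real.tendsto_nat_mul_log_one_add_of_tendsto (hr.congr' ?_)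
  filter_upwards [eventually_ge_atTop 1] with n hn
  have : (n : ℝ) ≠ 0 := by positivity
  field_simp

/-- A Stolz–Cesàro argument: the increments of `log U` and of `log n`, multiplied by `n`, tend to
`ρ` and `1`. -/
lemma tendsto_log_sum_div_log (hu0 : u 0 = 1) (hnn : ∀ n, 0 ≤ u n)
    (h : Tendsto (fun n : ℕ => n * u n / ∑ k ∈ Finset.range n, u k) atTop (𝓝 ρ)) :
    Tendsto (fun n : ℕ => Real.log (∑ k ∈ Finset.range n, u k) / Real.log n) atTop (𝓝 ρ) := by
  have hU1 : ∀ n, 1 ≤ n → 1 ≤ ∑ k ∈ Finset.range n, u k := fun n hn => by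
    rw [← hu0]
    exact Finset.single_le_sum (f := u) (fun k _ => hnn k) (by simp; omega)
  let g : ℕ → ℝ := fun n => Real.log ((n + 1 : ℕ) : ℝ) - Real.log n
  let f : ℕ → ℝ := fun n => Real.log (∑ k ∈ Finset.range (n + 1), u k) -
    Real.log (∑ k ∈ Finset.range n, u k)
  -- Both telescoping sums rely on `Real.log 0 = 0` at their lower end.
  have hgs (n : ℕ) : ∑ i ∈ Finset.range n, g i = Real.log n := by
    rw [Finset.sum_range_sub fun n : ℕ => Real.log (n : ℝ)]; simp
  have hfs (n : ℕ) : ∑ i ∈ Finset.range n, f i = Real.log (∑ k ∈ Finset.range n, u k) := by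
    rw [Finset.sum_range_sub fun n : ℕ => Real.log (∑ k ∈ Finset.range n, u k)]; simp
  have hg0 : 0 ≤ g := fun n => by
    rcases Nat.eq_zero_or_pos n with rfl | hn
    · simp [g]
    · exact sub_nonneg.2 (Real.log_le_log (by positivity) (by push_cast; linarith))
  have hng : Tendsto (fun n : ℕ => n * g n) atTop (𝓝 1) := by
    refine (tendsto_mul_log_one_add (tendsto_const_nhds (x := (1 : ℝ)))).congr' ?_
    filter_upwards [eventually_ge_atTop 1] with n hn
    have : (0 : ℝ) < n := by positivity
    simp only [g]
    rw [← Real.log_div (by positivity) (by positivity)]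
    congr 2
    push_cast
    field_simp
  have hnf : Tendsto (fun n : ℕ => n * f n) atTop (𝓝 ρ) := by
    refine (tendsto_mul_log_one_add h).congr' ?_
    filter_upwards [eventually_ge_atTop 1] with n hn
    have h1 : (0 : ℝ) < n := by positivity
    have h2 := one_pos.trans_le (hU1 n hn)
    have h3 := one_pos.trans_le (hU1 (n + 1) (by omega))
    simp only [f]
    rw [← Real.log_div h3.ne' h2.ne', Finset.sum_range_succ]
    congr 2
    field_simp
  have hlog : Tendsto (fun n : ℕ => Real.log (n : ℝ)) atTop atTop :=
    Real.tendsto_log_atTop.comp tendsto_natCast_atTop_atTop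
  have ho : (fun n => f n - ρ * g n) =o[atTop] g := by
    have hne : ∀ᶠ n : ℕ in atTop, (n : ℝ) * g n ≠ 0 :=
      hng.eventually_ne one_ne_zero
    rw [Asymptotics.isLittleO_iff_tendsto' (by
      filter_upwards [hne] with n hn h0
      simp [h0] at hn)]
    have : Tendsto (fun n : ℕ => (n * f n - ρ * (n * g n)) / (n * g n)) atTop
        (𝓝 ((ρ - ρ * 1) / 1)) := (hnf.sub (hng.const_mul ρ)).div hng one_ne_zero
    simp only [mul_one, sub_self, zero_div] at this
    refine this.congr' ?_
    filter_upwards [hne] with n hn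
    have h1 := left_ne_zero_of_mul hn
    rw [show n * f n - ρ * (n * g n) = n * (f n - ρ * g n) by ring, mul_div_mul_left _ _ h1]
  have hs := ho.sum_range hg0 (by simpa only [hgs] using hlog)
  simp only [Finset.sum_sub_distrib, ← Finset.mul_sum, hgs, hfs] at hs
  have := hs.tendsto_div_nhds_zero.add_const ρ
  rw [zero_add] at this
  refine this.congr' ?_
  filter_upwards [hlog.eventually_gt_atTop 0] with n hn
  field_simp
  ring

/-- Write `u n = (n * u n / U n) * U n / n`; the first factor tends to `ρ > 0`, so its logarithm is
negligible against `log n`. -/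
lemma tendsto_log_div_log_of_log_deriv (hu0 : u 0 = 1) (hanti : Antitone u) (hpos : ∀ n, 0 < u n)
    (hrec : ∀ n : ℕ, n * u n = ∑ k ∈ Finset.Ioc 0 n, a k * u (n - k))
    (ha : Tendsto a atTop (𝓝 ρ)) (hρ : 0 < ρ) :
    Tendsto (fun n : ℕ => Real.log (u n) / Real.log n) atTop (𝓝 (ρ - 1)) := by
  have hnn n := (hpos n).le
  have h1 := tendsto_mul_div_sum hu0 hanti hnn hrec ha
  have h2 := tendsto_log_sum_div_log hu0 hnn h1
  have hlog : Tendsto (fun n : ℕ => Real.log (n : ℝ)) atTop atTop :=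
    Real.tendsto_log_atTop.comp tendsto_natCast_atTop_atTop
  have h3 := ((h1.log hρ.ne').div_atTop hlog).add (h2.sub_const 1)
  rw [zero_add] at h3
  refine h3.congr' ?_
  filter_upwards [hlog.eventually_gt_atTop 0, eventually_ge_atTop 1] with n hn hn1
  have hn0 : (n : ℝ) ≠ 0 := by positivity
  have hU : ∑ k ∈ Finset.range n, u k ≠ 0 :=
    (Finset.sum_pos (fun k _ => hpos k) ⟨0, by simp; omega⟩).ne'
  rw [Real.log_div (mul_ne_zero hn0 (hpos n).ne') hU, Real.log_mul hn0 (hpos n).ne']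
  field_simp
  ring

end Asymptotics

/-! ### Transfer from the random variables to the product measure -/

lemma persistent_zero : persistent 0 = Set.univ := by
  ext x
  simp [persistent, walk]

lemma persistent_anti : Antitone persistent := fun _ _ hmn _ hx k hk => hx k (hk.trans hmn)

section

variable {Ω : Type*} [MeasurableSpace Ω] {μ : Measure Ω} [IsProbabilityMeasure μ] {ξ : ℕ → Ω → ℝ}

lemma map_eq_infinitePi_of_iid (hmeas : ∀ i, Measurable (ξ i)) (hindep : iIndepFun ξ μ)
    (hident : ∀ i, IdentDistrib (ξ i) (ξ 0) μ μ) :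
    μ.map (fun ω i => ξ i ω) = Measure.infinitePi fun _ : ℕ => μ.map (ξ 0) := by
  rw [iIndepFun_iff_map_fun_eq_infinitePi_map hmeas] at hindep
  rw [hindep]
  congr 1
  funext i
  exact (hident i).map_eq

lemma isStationarySeq_of_iid (hmeas : ∀ i, Measurable (ξ i)) (hindep : iIndepFun ξ μ)
    (hident : ∀ i, IdentDistrib (ξ i) (ξ 0) μ μ) : IsStationarySeq μ ξ := by
  refine ⟨by fun_prop, by fun_prop, ?_⟩
  rw [map_eq_infinitePi_of_iid hmeas hindep hident, map_eq_infinitePi_of_iid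
    (ξ := fun i => ξ (i + 1)) (fun i => hmeas _) (hindep.precomp (add_left_injective 1))
    fun i => (hident _).trans (hident _).symm]
  congr 1
  funext i
  exact (hident 1).map_eq

lemma persistenceProb_eq_infinitePi (hmeas : ∀ i, Measurable (ξ i)) (hindep : iIndepFun ξ μ)
    (hident : ∀ i, IdentDistrib (ξ i) (ξ 0) μ μ) (n : ℕ) :
    persistenceProb μ ξ n =
      (Measure.infinitePi fun _ : ℕ => μ.map (ξ 0)).real (persistent n) := by
  rw [← map_eq_infinitePi_of_iid hmeas hindep hident,
    map_measureReal_apply (by fun_prop) (measurableSet_persistent n)]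
  unfold persistenceProb
  congr 1
  ext ω
  refine forall_congr' fun k => ⟨fun h hk => ?_, fun h _ hk => h hk⟩
  rcases Nat.eq_zero_or_pos k with rfl | hk0
  · simp [walk]
  · exact h hk0 hk

lemma one_sub_negProb_eq_infinitePi (hmeas : ∀ i, Measurable (ξ i)) (hindep : iIndepFun ξ μ)
    (hident : ∀ i, IdentDistrib (ξ i) (ξ 0) μ μ) (n : ℕ) :
    1 - negProb μ ξ n =
      (Measure.infinitePi fun _ : ℕ => μ.map (ξ 0)).real {x | 0 ≤ walk x n} := by
  have hS : Measurable (partialSum ξ n) := by unfold partialSum; fun_prop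
  rw [← map_eq_infinitePi_of_iid hmeas hindep hident,
    map_measureReal_apply (by fun_prop) (measurableSet_le (by fun_prop) (by fun_prop)), negProb,
    ← probReal_compl_eq_one_sub (measurableSet_lt hS (by fun_prop))]
  congr 1
  ext ω
  exact not_lt (a := partialSum ξ n ω) (b := 0)

end

theorem proposition1p2 {Ω : Type*} [MeasurableSpace Ω] (μ : Measure Ω) [IsProbabilityMeasure μ]
    (ξ : ℕ → Ω → ℝ) (hmeas : ∀ i, Measurable (ξ i))
    (hindep : iIndepFun ξ μ) (hident : ∀ i, IdentDistrib (ξ i) (ξ 0) μ μ)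
    (q : ℝ) (hq : Tendsto (fun n : ℕ => negProb μ ξ n) atTop (𝓝 q)) (hq1 : q < 1) :
    IsPersistentlyPowerSkewed μ ξ ∧
      Tendsto (fun n : ℕ => Real.log (persistenceProb μ ξ n) / Real.log (n : ℝ))
        atTop (𝓝 (-q)) := by
  let ν : Measure ℝ := μ.map (ξ 0)
  have : IsProbabilityMeasure ν := Measure.isProbabilityMeasure_map (hmeas 0).aemeasurable
  have hp := persistenceProb_eq_infinitePi hmeas hindep hident
  have hn := one_sub_negProb_eq_infinitePi hmeas hindep hident
  have hu0 : persistenceProb μ ξ 0 = 1 := by rw [hp, persistent_zero, probReal_univ]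
  have hanti : Antitone (persistenceProb μ ξ) := fun m n hmn => by
    rw [hp, hp]
    exact measureReal_mono (persistent_anti hmn)
  have hrec := renewal_log_deriv (u := persistenceProb μ ξ) (a := fun n => 1 - negProb μ ξ n)
    (f := fun k => (Measure.infinitePi fun _ : ℕ => ν).real (strictMinAt k)) hu0
    (fun n hn0 => by simp only [hp]; exact infinitePi_real_persistent ν hn0)
    (fun n hn0 => by simp only [hp, hn]; exact infinitePi_real_walk_nonneg ν hn0)
  have ha : Tendsto (fun n => 1 - negProb μ ξ n) atTop (𝓝 (1 - q)) := hq.const_sub 1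
  have hpos := pos_of_log_deriv hu0 hanti (fun _ => measureReal_nonneg)
    (fun n => sub_nonneg.2 measureReal_le_one) hrec ha (by linarith)
  have hlim := tendsto_log_div_log_of_log_deriv hu0 hanti hpos hrec ha (by linarith)
  rw [show 1 - q - 1 = -q by ring] at hlim
  refine ⟨⟨isStationarySeq_of_iid hmeas hindep hident, hpos, ?_⟩, hlim⟩
  simpa using (hlim.add hq).abs
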